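/- Let $\mathcal H=\mathbb C^{d_1}\otimes\cdots\otimes\mathbb C^{d_n}$ be the Hilbert space of an $n$-party quantum system, $D=\dim\mathcal H$, and let $\sigma_1,\dots,\sigma_N$ ($N\ge 1$) be density matrices on $\mathcal H$ that are perfectly distinguishable by LOCC, i.e. there is an LOCC protocol (finitely many rounds; in each round one party performs a local measurement with finitely many outcomes, chosen depending on the earlier results, and broadcasts its result) which, run on $\sigma_j$, announces $j$ with probability $1$ (in particular the $\sigma_i$ are mutually orthogonal). Let $s_i$ be the support of $\sigma_i$, i.e. the span of its eigenvectors with nonzero eigenvalue. For a density matrix $\rho$ let $R(\rho)$ be its (global) robustness of entanglement, the minimal $t\ge 0$ such that $\frac{1}{1+t}(\rho+t\Delta)$ is fully separable for some density matrix $\Delta$; let $E_R(\rho)=\min_{\omega}\operatorname{Tr}\rho(\log_2\rho-\log_2\omega)$ be the relative entropy of entanglement, the minimum being over the fully separable states $\omega$ (the relative entropy is $+\infty$ if the support of $\rho$ is not contained in that of $\omega$); and for a unit vector $\psi$ let $E_g(\psi)=-\log_2\max_{\varphi}|\langle\varphi|\psi\rangle|^2$ be the geometric measure, the maximum being over the unit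 product vectors $\varphi$. Write $R(\psi)=R(|\psi\rangle\langle\psi|)$, $E_R(\psi)=E_R(|\psi\rangle\langle\psi|)$ and $\overline{x_i}=\frac1N\sum_{i=1}^N x_i$. Then there are mutually orthogonal unit vectors $\Psi_1,\dots,\Psi_N$ with $\Psi_i\in s_i$ and $R(\Psi_i)=\max\{R(\psi):\psi\in s_i,\ \|\psi\|=1\}$ for every $i$, and for all unit vectors $\Psi_1,\dots,\Psi_N$ with these two properties $$N\;\le\;\frac{D}{\overline{1+R(\Psi_i)}}\;\le\;\frac{D}{\overline{2^{E_R(\Psi_i)}}}\;\le\;\frac{D}{\overline{2^{E_g(\Psi_i)}}}.$$ -/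

import Mathlib

open scoped Matrix ComplexOrder

noncomputable section

/-- Index set of the computational product basis of `ℂ^{d 0} ⊗ ⋯ ⊗ ℂ^{d (n-1)}`. -/
abbrev Idx {n : ℕ} (d : Fin n → ℕ) : Type := (k : Fin n) → Fin (d k)

/-- The Hilbert space of the composite system whose `k`-th party holds `ℂ^{d k}`,
written in coordinates with respect to the product basis. -/
abbrev Hilb {n : ℕ} (d : Fin n → ℕ) : Type := EuclideanSpace ℂ (Idx d)

/-- Operators on the composite system. -/
abbrev Op {n : ℕ} (d : Fin n → ℕ) : Type := Matrix (Idx d) (Idx d) ℂ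

/-- Tensor (Kronecker) product of one operator for each party. -/
def tensorOp {n : ℕ} {d : Fin n → ℕ} (M : (k : Fin n) → Matrix (Fin (d k)) (Fin (d k)) ℂ) :
    Op d :=
  Matrix.of fun x y => ∏ k, M k (x k) (y k)

/-- Tensor product of one vector for each party. -/
def tensorVec {n : ℕ} {d : Fin n → ℕ} (v : (k : Fin n) → EuclideanSpace ℂ (Fin (d k))) :
    Hilb d :=
  WithLp.toLp 2 fun x => ∏ k, v k (x k)

/-- The operator acting as `A` on party `k` and as the identity on all other parties. -/
def localOp {n : ℕ} {d : Fin n → ℕ} (k : Fin n) (A : Matrix (Fin (d k)) (Fin (d k)) ℂ) : Op d :=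
  tensorOp (Function.update (fun _ => 1) k A)

/-- Density matrices: positive semidefinite with unit trace. -/
structure IsDensity {ι : Type} [Fintype ι] (ρ : Matrix ι ι ℂ) : Prop where
  posSemidef : ρ.PosSemidef
  trace_eq_one : ρ.trace = 1

/-- The rank-one operator `|ψ⟩⟨ψ|`. -/
def pureOp {n : ℕ} {d : Fin n → ℕ} (ψ : Hilb d) : Op d :=
  Matrix.vecMulVec ψ.ofLp (star ψ.ofLp)

/-- Fully separable states: convex combinations of tensor products of local density matrices. -/
def IsSeparableState {n : ℕ} {d : Fin n → ℕ} (ω : Op d) : Prop :=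
  ω ∈ convexHull ℝ {τ : Op d | ∃ M : (k : Fin n) → Matrix (Fin (d k)) (Fin (d k)) ℂ,
    (∀ k, IsDensity (M k)) ∧ τ = tensorOp M}

/-- The support of an operator: the span of its eigenvectors with nonzero eigenvalue. -/
def opSupport {n : ℕ} {d : Fin n → ℕ} (ρ : Op d) : Submodule ℂ (Hilb d) :=
  Submodule.span ℂ {v | ∃ μ : ℂ, μ ≠ 0 ∧ Matrix.toEuclideanLin ρ v = μ • v}

/-- LOCC protocols of finitely many rounds, at the end of which one of `N` outcomes is announced.
In each round one party `k` performs a local measurement with Kraus operators `A 0, …, A (m-1)`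
and broadcasts the result, on which everything that follows may depend. (Local randomness, shared
randomness, local unitaries, measurements through ancillas and coarse-grained instruments are all
obtained in this way.) -/
inductive LOCCProtocol {n : ℕ} (d : Fin n → ℕ) (N : ℕ) : Type
  | announce (i : Fin N) : LOCCProtocol d N
  | measure (k : Fin n) (m : ℕ) (A : Fin m → Matrix (Fin (d k)) (Fin (d k)) ℂ)
      (hA : ∑ j, (A j)ᴴ * A j = 1) (next : Fin m → LOCCProtocol d N) : LOCCProtocol d N

/-- Probability that the protocol, run on the (subnormalized) state `ρ`, announces `i`. -/
def LOCCProtocol.prob {n : ℕ} {d : Fin n → ℕ} {N : ℕ} :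
    LOCCProtocol d N → Op d → Fin N → ℝ
  | .announce i', ρ, i => if i' = i then ρ.trace.re else 0
  | .measure k _ A _ next, ρ, i =>
      ∑ j, (next j).prob (localOp k (A j) * ρ * (localOp k (A j))ᴴ) i

/-- Some LOCC protocol identifies each of the states `σ j` without error. -/
def PerfectlyLOCCDistinguishable {n : ℕ} {d : Fin n → ℕ} {N : ℕ} (σ : Fin N → Op d) : Prop :=
  ∃ P : LOCCProtocol d N, ∀ i j, P.prob (σ j) i = if i = j then 1 else 0

/-- (Global) robustness of entanglement: the least `t ≥ 0` such that mixing `ρ` with some state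
`Δ` in the proportion `1 : t` yields a separable state. -/
def robustness {n : ℕ} {d : Fin n → ℕ} (ρ : Op d) : ℝ :=
  sInf {t : ℝ | 0 ≤ t ∧ ∃ Δ : Op d, IsDensity Δ ∧
    IsSeparableState ((1 + t)⁻¹ • (ρ + t • Δ))}

/-- Binary logarithm of a positive semidefinite operator, taken on its support. -/
def opLog {n : ℕ} {d : Fin n → ℕ} (ρ : Op d) : Op d := cfc (Real.logb 2) ρ

open scoped Classical in
/-- Quantum relative entropy `Tr ρ (log₂ ρ - log₂ ω)`, which is `⊤` unless the support of `ρ` is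
contained in the support of `ω`. -/
def relEntropy {n : ℕ} {d : Fin n → ℕ} (ρ ω : Op d) : EReal :=
  if opSupport ρ ≤ opSupport ω then (((ρ * (opLog ρ - opLog ω)).trace.re : ℝ) : EReal) else ⊤

/-- Relative entropy of entanglement: the least relative entropy to a separable state
(the infimum is taken over the finite values, of which there are some: the maximally mixed state
is separable and has full support). -/
def relEntropyEnt {n : ℕ} {d : Fin n → ℕ} (ρ : Op d) : ℝ :=
  sInf {x : ℝ | ∃ ω : Op d, IsSeparableState ω ∧ relEntropy ρ ω = (x : EReal)}

/-- Geometric measure of entanglement of a pure state: `-log₂` of the maximal squared overlap with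
a product state. -/
def geometricMeasure {n : ℕ} {d : Fin n → ℕ} (ψ : Hilb d) : ℝ :=
  -Real.logb 2 (sSup {x : ℝ | ∃ v : (k : Fin n) → EuclideanSpace ℂ (Fin (d k)),
    (∀ k, ‖v k‖ = 1) ∧ x = ‖inner ℂ (tensorVec v) ψ‖ ^ 2})

/-- `Ψ` is a pure state in the subspace `s` whose robustness is maximal among the pure states
in `s`. -/
def IsMaxRobust {n : ℕ} {d : Fin n → ℕ} (s : Submodule ℂ (Hilb d)) (Ψ : Hilb d) : Prop :=
  Ψ ∈ s ∧ ‖Ψ‖ = 1 ∧ ∀ ψ ∈ s, ‖ψ‖ = 1 → robustness (pureOp ψ) ≤ robustness (pureOp Ψ)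

/-- The average of a finite family of real numbers. -/
def avg {N : ℕ} (x : Fin N → ℝ) : ℝ := (∑ i, x i) / N

end

/-!
A protocol in which the parties measure one after the other implements, as far as its final
announcement is concerned, a measurement with effects `E i` that sum to the identity and are sums
of tensor products of positive local operators (`LOCCProtocol.sum_effect`,
`LOCCProtocol.effect_mem_sepCone`). If it identifies the states `σ j` without error, then `E i` is
the identity on the support of `σ i` and vanishes on the other supports
(`LOCCProtocol.effect_mulVec`); this makes the supports orthogonal.

For a unit vector `ψ` in the support of `σ i`, the positive operator `E i` fixes `ψ`, hence
dominates `|ψ⟩⟨ψ|`. So the separable state `E i / tr (E i)` is a mixture of `|ψ⟩⟨ψ|` with another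
state, which shows `1 + R(ψ) ≤ tr (E i)` (`one_add_robustness_le_trace`). Summing over `i` gives
`∑ i, (1 + R(Ψ i)) ≤ tr 1 = D`, the first inequality.

The other two compare the three measures on one pure state. If a separable `ω` satisfies
`|ψ⟩⟨ψ| ≤ r ω`, then `⟨ψ| ω⁻¹ |ψ⟩ ≤ r`, and Jensen's inequality in an eigenbasis of `ω` gives
`-⟨ψ| log₂ ω |ψ⟩ ≤ log₂ r`; hence `2 ^ E_R(ψ) ≤ 1 + R(ψ)` (`two_rpow_relEntropyEnt_le`).
Jensen's inequality in the other direction gives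
`-⟨ψ| log₂ ω |ψ⟩ ≥ -log₂ ⟨ψ| ω |ψ⟩`, and `⟨ψ| ω |ψ⟩` is an average of squared overlaps of `ψ` with
product vectors; hence `E_g(ψ) ≤ E_R(ψ)` (`geometricMeasure_le_relEntropyEnt`).

The maximum of the robustness over the unit vectors of a subspace is attained because the
robustness is Lipschitz continuous on the unit sphere (`robustness_le_add`).
-/

/-! ### Tensor products of local operators -/

section TensorOp

variable {n : ℕ} {d : Fin n → ℕ}

theorem tensorOp_mul (A B : (k : Fin n) → Matrix (Fin (d k)) (Fin (d k)) ℂ) :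
    tensorOp A * tensorOp B = tensorOp fun k => A k * B k := by
  ext x y
  simp only [tensorOp, Matrix.mul_apply, Matrix.of_apply]
  rw [Finset.prod_univ_sum, Fintype.piFinset_univ]
  simp [Finset.prod_mul_distrib]

theorem tensorOp_conjTranspose (A : (k : Fin n) → Matrix (Fin (d k)) (Fin (d k)) ℂ) :
    (tensorOp A)ᴴ = tensorOp fun k => (A k)ᴴ := by
  ext x y
  simp [tensorOp, Matrix.conjTranspose_apply]

theorem tensorOp_diagonal (a : (k : Fin n) → Fin (d k) → ℂ) :
    tensorOp (fun k => Matrix.diagonal (a k)) = Matrix.diagonal fun x => ∏ k, a k (x k) := by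
  ext x y
  by_cases h : x = y
  · subst h; simp [tensorOp]
  · obtain ⟨k, hk⟩ := Function.ne_iff.mp h
    rw [Matrix.diagonal_apply_ne _ h]
    simpa [tensorOp] using Finset.prod_eq_zero (Finset.mem_univ k) (by simp [Matrix.diagonal_apply_ne _ hk])

theorem tensorOp_one :
    tensorOp (fun k => (1 : Matrix (Fin (d k)) (Fin (d k)) ℂ)) = 1 := by
  simpa using tensorOp_diagonal (d := d) fun _ _ => 1

theorem tensorOp_smul (c : Fin n → ℝ) (A : (k : Fin n) → Matrix (Fin (d k)) (Fin (d k)) ℂ) :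
    tensorOp (fun k => c k • A k) = (∏ k, c k) • tensorOp A := by
  ext x y
  simp [tensorOp, Finset.prod_mul_distrib]

theorem trace_tensorOp (A : (k : Fin n) → Matrix (Fin (d k)) (Fin (d k)) ℂ) :
    (tensorOp A).trace = ∏ k, (A k).trace := by
  simp only [Matrix.trace, Matrix.diag, tensorOp, Matrix.of_apply]
  rw [Finset.prod_univ_sum, Fintype.piFinset_univ]

theorem exists_eq_conjTranspose_mul_self {ι : Type*} [Fintype ι] {A : Matrix ι ι ℂ}
    (hA : A.PosSemidef) : ∃ B : Matrix ι ι ℂ, A = Bᴴ * B := by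
  classical
  open scoped MatrixOrder in
  exact (CStarAlgebra.nonneg_iff_eq_star_mul_self (a := A)).mp hA.nonneg

theorem posSemidef_tensorOp {A : (k : Fin n) → Matrix (Fin (d k)) (Fin (d k)) ℂ}
    (hA : ∀ k, (A k).PosSemidef) : (tensorOp A).PosSemidef := by
  choose B hB using fun k => exists_eq_conjTranspose_mul_self (hA k)
  have : tensorOp A = (tensorOp B)ᴴ * tensorOp B := by
    rw [tensorOp_conjTranspose, tensorOp_mul]
    exact congrArg _ (funext hB)
  rw [this]
  exact Matrix.posSemidef_conjTranspose_mul_self _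

theorem localOp_apply (k : Fin n) (A : Matrix (Fin (d k)) (Fin (d k)) ℂ) (x y : Idx d) :
    localOp k A x y =
      A (x k) (y k) * ∏ l ∈ Finset.univ.erase k,
        (1 : Matrix (Fin (d l)) (Fin (d l)) ℂ) (x l) (y l) := by
  simp only [localOp, tensorOp, Matrix.of_apply]
  rw [← Finset.mul_prod_erase _ _ (Finset.mem_univ k), Function.update_self]
  congr 1
  refine Finset.prod_congr rfl fun l hl => ?_
  rw [Function.update_of_ne (Finset.ne_of_mem_erase hl)]

theorem localOp_sum (k : Fin n) {m : ℕ} (A : Fin m → Matrix (Fin (d k)) (Fin (d k)) ℂ) :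
    localOp k (∑ j, A j) = ∑ j, localOp k (A j) := by
  ext x y
  simp only [localOp_apply, Matrix.sum_apply, Finset.sum_mul]

theorem localOp_one (k : Fin n) :
    localOp k (1 : Matrix (Fin (d k)) (Fin (d k)) ℂ) = 1 := by
  rw [← tensorOp_one, localOp]
  exact congrArg _ (Function.update_eq_self k _)

theorem localOp_conjTranspose_mul_self (k : Fin n) (A : Matrix (Fin (d k)) (Fin (d k)) ℂ) :
    (localOp k A)ᴴ * localOp k A = localOp k (Aᴴ * A) := by
  simp only [localOp, tensorOp_conjTranspose, tensorOp_mul]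
  congr 1
  funext l
  by_cases h : l = k
  · subst h; simp
  · simp [h]

end TensorOp

/-! ### Separable states and the cone of separable operators -/

section Separable

variable {n : ℕ} {d : Fin n → ℕ}

/-- The convex cone of (unnormalized) separable operators, encoded as the additive monoid
generated by the tensor products of positive semidefinite local operators. -/
def sepCone {n : ℕ} (d : Fin n → ℕ) : AddSubmonoid (Op d) :=
  AddSubmonoid.closure {X | ∃ M : (k : Fin n) → Matrix (Fin (d k)) (Fin (d k)) ℂ,
    (∀ k, (M k).PosSemidef) ∧ X = tensorOp M}

theorem tensorOp_mem_sepCone {M : (k : Fin n) → Matrix (Fin (d k)) (Fin (d k)) ℂ}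
    (hM : ∀ k, (M k).PosSemidef) : tensorOp M ∈ sepCone d :=
  AddSubmonoid.subset_closure ⟨M, hM, rfl⟩

theorem one_mem_sepCone : (1 : Op d) ∈ sepCone d :=
  tensorOp_one (d := d) ▸ tensorOp_mem_sepCone fun _ => Matrix.PosSemidef.one

/-- The separable cone is invariant under the (Heisenberg picture) action of local operators. -/
theorem localOp_conj_mem_sepCone (k : Fin n) (A : Matrix (Fin (d k)) (Fin (d k)) ℂ) {X : Op d}
    (hX : X ∈ sepCone d) : (localOp k A)ᴴ * X * localOp k A ∈ sepCone d := by
  induction hX using AddSubmonoid.closure_induction with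
  | mem X hX =>
    obtain ⟨M, hM, rfl⟩ := hX
    simp only [localOp, tensorOp_conjTranspose, tensorOp_mul]
    exact tensorOp_mem_sepCone fun l => (hM l).conjTranspose_mul_mul_same _
  | zero => simp
  | add X Y _ _ hX hY =>
    rw [mul_add, add_mul]
    exact add_mem hX hY

theorem posSemidef_of_mem_sepCone {X : Op d} (hX : X ∈ sepCone d) : X.PosSemidef := by
  induction hX using AddSubmonoid.closure_induction with
  | mem X hX =>
    obtain ⟨M, hM, rfl⟩ := hX
    exact posSemidef_tensorOp hM
  | zero => exact Matrix.PosSemidef.zero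
  | add X Y _ _ hX hY => exact hX.add hY

theorem trace_eq_re {ι : Type*} [Fintype ι] {A : Matrix ι ι ℂ} (hA : A.PosSemidef) :
    A.trace = (A.trace.re : ℂ) :=
  Complex.eq_re_of_ofReal_le (r := 0) (by simpa using hA.trace_nonneg)

theorem posSemidef_real_smul {ι : Type*} {A : Matrix ι ι ℂ} (hA : A.PosSemidef) {c : ℝ}
    (hc : 0 ≤ c) : (c • A).PosSemidef := by
  rw [← Complex.coe_smul]
  exact hA.smul (by exact_mod_cast hc)

theorem trace_re_pos {ι : Type*} [Fintype ι] {A : Matrix ι ι ℂ} (hA : A.PosSemidef)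
    (h0 : A ≠ 0) : 0 < A.trace.re := by
  classical
  have h1 : 0 ≤ A.trace.re := (Complex.nonneg_iff.mp hA.trace_nonneg).1
  refine lt_of_le_of_ne h1 fun h => h0 (hA.trace_eq_zero_iff.mp ?_)
  rw [trace_eq_re hA, ← h, Complex.ofReal_zero]

theorem isDensity_inv_trace_smul {ι : Type} [Fintype ι] {A : Matrix ι ι ℂ} (hA : A.PosSemidef)
    (h0 : A ≠ 0) : IsDensity (A.trace.re⁻¹ • A) := by
  have hp := trace_re_pos hA h0
  refine ⟨posSemidef_real_smul hA (inv_nonneg.mpr hp.le), ?_⟩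
  rw [Matrix.trace_smul]
  nth_rewrite 2 [trace_eq_re hA]
  rw [Complex.real_smul, ← Complex.ofReal_mul, inv_mul_cancel₀ hp.ne', Complex.ofReal_one]

theorem convex_isDensity {ι : Type} [Fintype ι] : Convex ℝ {ρ : Matrix ι ι ℂ | IsDensity ρ} := by
  intro A hA B hB a b ha hb hab
  refine ⟨(posSemidef_real_smul hA.1 ha).add (posSemidef_real_smul hB.1 hb), ?_⟩
  rw [Matrix.trace_add, Matrix.trace_smul, Matrix.trace_smul, hA.2, hB.2, ← add_smul, hab,
    one_smul]

theorem isDensity_tensorOp {M : (k : Fin n) → Matrix (Fin (d k)) (Fin (d k)) ℂ}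
    (hM : ∀ k, IsDensity (M k)) : IsDensity (tensorOp M) :=
  ⟨posSemidef_tensorOp fun k => (hM k).1, by simp [trace_tensorOp, (hM _).2]⟩

theorem IsSeparableState.isDensity {ω : Op d} (hω : IsSeparableState ω) : IsDensity ω := by
  refine convexHull_min ?_ convex_isDensity hω
  rintro _ ⟨M, hM, rfl⟩
  exact isDensity_tensorOp hM

theorem IsSeparableState.smul_add_smul {ω τ : Op d} (hω : IsSeparableState ω)
    (hτ : IsSeparableState τ) {r s : ℝ} (hr : 0 < r) (hs : 0 ≤ s) :
    ∃ ω', IsSeparableState ω' ∧ r • ω + s • τ = (r + s) • ω' := by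
  have hrs : 0 < r + s := add_pos_of_pos_of_nonneg hr hs
  refine ⟨(r / (r + s)) • ω + (s / (r + s)) • τ,
    convex_convexHull ℝ _ hω hτ (by positivity) (by positivity) ?_, ?_⟩
  · field_simp
  · rw [smul_add, smul_smul, smul_smul, mul_div_cancel₀ _ hrs.ne', mul_div_cancel₀ _ hrs.ne']

/-- A nonzero separable operator is a positive multiple of a separable state. -/
theorem eq_zero_or_eq_smul_of_mem_sepCone {X : Op d} (hX : X ∈ sepCone d) :
    X = 0 ∨ ∃ r : ℝ, 0 < r ∧ ∃ ω, IsSeparableState ω ∧ X = r • ω := by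
  induction hX using AddSubmonoid.closure_induction with
  | mem X hX =>
    obtain ⟨M, hM, rfl⟩ := hX
    by_cases h : ∃ k, M k = 0
    · obtain ⟨k, hk⟩ := h
      left
      ext x y
      simpa [tensorOp] using Finset.prod_eq_zero (Finset.mem_univ k) (by simp [hk])
    · push Not at h
      right
      have hp : ∀ k, 0 < (M k).trace.re := fun k => trace_re_pos (hM k) (h k)
      refine ⟨∏ k, (M k).trace.re, Finset.prod_pos fun k _ => hp k,
        tensorOp fun k => (M k).trace.re⁻¹ • M k, subset_convexHull ℝ _
          ⟨_, fun k => isDensity_inv_trace_smul (hM k) (h k), rfl⟩, ?_⟩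
      rw [← tensorOp_smul]
      congr 1
      funext k
      rw [smul_smul, mul_inv_cancel₀ (hp k).ne', one_smul]
  | zero => exact Or.inl rfl
  | add X Y _ _ hX hY =>
    rcases hX with rfl | ⟨r, hr, ω, hω, rfl⟩
    · simpa using hY
    rcases hY with rfl | ⟨s, hs, τ, hτ, rfl⟩
    · right
      exact ⟨r, hr, ω, hω, by simp⟩
    right
    obtain ⟨ω', hω', h⟩ := hω.smul_add_smul hτ hr hs.le
    exact ⟨r + s, add_pos hr hs, ω', hω', h⟩

end Separable

/-! ### Pure states -/

section Pure

variable {n : ℕ} {d : Fin n → ℕ}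

theorem pureOp_mulVec (ψ : Hilb d) (v : Idx d → ℂ) :
    pureOp ψ *ᵥ v = (star ψ.ofLp ⬝ᵥ v) • ψ.ofLp := by
  rw [pureOp, Matrix.vecMulVec_mulVec, op_smul_eq_smul]

theorem star_dotProduct_self (ψ : Hilb d) : star ψ.ofLp ⬝ᵥ ψ.ofLp = ((‖ψ‖ ^ 2 : ℝ) : ℂ) := by
  rw [dotProduct_comm, ← EuclideanSpace.inner_eq_star_dotProduct, inner_self_eq_norm_sq_to_K]
  simp

theorem star_dotProduct_self_eq_one {ψ : Hilb d} (hψ : ‖ψ‖ = 1) :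
    star ψ.ofLp ⬝ᵥ ψ.ofLp = 1 := by
  rw [star_dotProduct_self, hψ]
  simp

theorem posSemidef_pureOp (ψ : Hilb d) : (pureOp ψ).PosSemidef :=
  Matrix.posSemidef_vecMulVec_self_star _

theorem isDensity_pureOp {ψ : Hilb d} (hψ : ‖ψ‖ = 1) : IsDensity (pureOp ψ) :=
  ⟨posSemidef_pureOp ψ, by
    rw [pureOp, Matrix.trace_vecMulVec, dotProduct_comm, star_dotProduct_self_eq_one hψ]⟩

theorem mul_pureOp (A : Op d) (ψ : Hilb d) :
    A * pureOp ψ = Matrix.vecMulVec (A *ᵥ ψ.ofLp) (star ψ.ofLp) := by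
  rw [pureOp, Matrix.mul_vecMulVec]

theorem pureOp_mul_self {ψ : Hilb d} (hψ : ‖ψ‖ = 1) : pureOp ψ * pureOp ψ = pureOp ψ := by
  rw [mul_pureOp, pureOp_mulVec, star_dotProduct_self_eq_one hψ, one_smul, pureOp]

theorem trace_pureOp_mul (ψ : Hilb d) (A : Op d) :
    (pureOp ψ * A).trace = star ψ.ofLp ⬝ᵥ A *ᵥ ψ.ofLp := by
  rw [Matrix.trace_mul_comm, mul_pureOp, Matrix.trace_vecMulVec, dotProduct_comm]

/-- A positive operator that fixes the unit vector `ψ` dominates `|ψ⟩⟨ψ|`: the difference is the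
compression of the operator to the orthogonal complement of `ψ`. -/
theorem posSemidef_sub_pureOp {E : Op d} (hE : E.PosSemidef) {ψ : Hilb d} (hψ : ‖ψ‖ = 1)
    (hfix : E *ᵥ ψ.ofLp = ψ.ofLp) : (E - pureOp ψ).PosSemidef := by
  have hP : (pureOp ψ)ᴴ = pureOp ψ := (posSemidef_pureOp ψ).1
  have h1 : E * pureOp ψ = pureOp ψ := by rw [mul_pureOp, hfix, pureOp]
  have h2 : pureOp ψ * E = pureOp ψ := by
    have := congrArg Matrix.conjTranspose h1
    rwa [Matrix.conjTranspose_mul, hP, hE.1] at this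
  have h := hE.conjTranspose_mul_mul_same (1 - pureOp ψ)
  rw [Matrix.conjTranspose_sub, hP, Matrix.conjTranspose_one] at h
  convert h using 1
  rw [sub_mul, one_mul, h2, mul_sub, mul_one, sub_mul, h1, pureOp_mul_self hψ]
  abel

/-- `ψ ↦ |ψ⟩⟨ψ|` is Lipschitz on the unit sphere, in the Loewner order. -/
theorem posSemidef_add_pureOp_sub_pureOp {φ ψ : Hilb d} (hφ : ‖φ‖ = 1) (hψ : ‖ψ‖ = 1) :
    ((2 * ‖ψ - φ‖) • (1 : Op d) + pureOp φ - pureOp ψ).PosSemidef := by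
  refine Matrix.PosSemidef.of_dotProduct_mulVec_nonneg (((posSemidef_real_smul
    Matrix.PosSemidef.one (by positivity)).add (posSemidef_pureOp φ)).1.sub
      (posSemidef_pureOp ψ).1) fun x => ?_
  have key : ∀ χ : Hilb d, star x ⬝ᵥ pureOp χ *ᵥ x
      = ((‖inner ℂ χ (WithLp.toLp 2 x)‖ ^ 2 : ℝ) : ℂ) := fun χ => by
    have h1 : inner ℂ χ (WithLp.toLp 2 x) = star χ.ofLp ⬝ᵥ x := by
      rw [EuclideanSpace.inner_eq_star_dotProduct, dotProduct_comm]
    have h2 : star x ⬝ᵥ χ.ofLp = star (star χ.ofLp ⬝ᵥ x) := Matrix.star_dotProduct _ _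
    rw [pureOp_mulVec, dotProduct_smul, h2, h1, smul_eq_mul, Complex.star_def, Complex.mul_conj,
      Complex.normSq_eq_norm_sq]
  have hx : star x ⬝ᵥ x = ((‖WithLp.toLp 2 x‖ ^ 2 : ℝ) : ℂ) :=
    star_dotProduct_self (WithLp.toLp 2 x)
  rw [Matrix.sub_mulVec, Matrix.add_mulVec, dotProduct_sub, dotProduct_add, key, key,
    Matrix.smul_mulVec, Matrix.one_mulVec, dotProduct_smul, hx, Complex.real_smul,
    ← Complex.ofReal_mul, ← Complex.ofReal_add, ← Complex.ofReal_sub, Complex.zero_le_real]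
  set v : Hilb d := WithLp.toLp 2 x
  have h1 : ‖inner ℂ ψ v‖ ≤ ‖v‖ := by simpa [hψ] using norm_inner_le_norm (𝕜 := ℂ) ψ v
  have h2 : ‖inner ℂ φ v‖ ≤ ‖v‖ := by simpa [hφ] using norm_inner_le_norm (𝕜 := ℂ) φ v
  have h3 : ‖inner ℂ ψ v‖ - ‖inner ℂ φ v‖ ≤ ‖ψ - φ‖ * ‖v‖ := by
    refine (norm_sub_norm_le _ _).trans ?_
    rw [← inner_sub_left]
    exact norm_inner_le_norm _ _
  have h4 : (‖inner ℂ ψ v‖ - ‖inner ℂ φ v‖) * (‖inner ℂ ψ v‖ + ‖inner ℂ φ v‖)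
      ≤ (‖ψ - φ‖ * ‖v‖) * (2 * ‖v‖) :=
    mul_le_mul h3 (by linarith) (by positivity) (by positivity)
  nlinarith [h4]

theorem mem_opSupport_pureOp {ψ : Hilb d} (hψ : ‖ψ‖ = 1) : ψ ∈ opSupport (pureOp ψ) := by
  refine Submodule.subset_span ⟨1, one_ne_zero, ?_⟩
  rw [Matrix.toLpLin_apply, pureOp_mulVec, star_dotProduct_self_eq_one hψ]
  simp

end Pure

/-! ### Bounds on the robustness -/

section Robustness

variable {n : ℕ} {d : Fin n → ℕ}

/-- If `r • ω` dominates the state `ρ`, with `ω` separable, then `r - 1` is an admissible amount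
of noise in the definition of the robustness of `ρ`. -/
theorem admissible_of_posSemidef {ρ ω : Op d} (hρ : IsDensity ρ) (hω : IsSeparableState ω) {r : ℝ}
    (h : (r • ω - ρ).PosSemidef) :
    0 ≤ r - 1 ∧ ∃ Δ : Op d, IsDensity Δ ∧
      IsSeparableState ((1 + (r - 1))⁻¹ • (ρ + (r - 1) • Δ)) := by
  have htr : (r • ω - ρ).trace = ((r - 1 : ℝ) : ℂ) := by
    rw [Matrix.trace_sub, Matrix.trace_smul, hω.isDensity.2, hρ.2]
    simp
  have h0 : 0 ≤ r - 1 := by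
    have := h.trace_nonneg
    rwa [htr, Complex.zero_le_real] at this
  refine ⟨h0, ?_⟩
  have hr : r ≠ 0 := by linarith
  by_cases hX : r • ω - ρ = 0
  · -- The noise is then of weight `0`, so any state will do.
    have h1 : r - 1 = 0 := by
      rw [hX, Matrix.trace_zero] at htr
      exact_mod_cast htr.symm
    refine ⟨ρ, hρ, ?_⟩
    rw [h1, zero_smul, add_zero, add_zero, inv_one, one_smul, ← sub_eq_zero.mp hX,
      sub_eq_zero.mp h1, one_smul]
    exact hω
  · have h1 := trace_re_pos h hX
    refine ⟨_, isDensity_inv_trace_smul h hX, ?_⟩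
    rw [htr, Complex.ofReal_re] at h1 ⊢
    rw [smul_smul, mul_inv_cancel₀ h1.ne', one_smul, add_sub_cancel, add_sub_cancel, smul_smul,
      inv_mul_cancel₀ hr, one_smul]
    exact hω

theorem one_add_robustness_le {ρ ω : Op d} (hρ : IsDensity ρ) (hω : IsSeparableState ω) {r : ℝ}
    (h : (r • ω - ρ).PosSemidef) : 1 + robustness ρ ≤ r := by
  have : robustness ρ ≤ r - 1 :=
    csInf_le ⟨0, fun t ht => ht.1⟩ (admissible_of_posSemidef hρ hω h)
  linarith

theorem zero_le_robustness (ρ : Op d) : 0 ≤ robustness ρ :=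
  Real.sInf_nonneg fun _ ht => ht.1

/-- In nonzero dimension the identity is a positive multiple of a separable state, the maximally
mixed one. -/
theorem exists_smul_eq_one [Nonempty (Idx d)] :
    ∃ r : ℝ, 0 < r ∧ ∃ τ : Op d, IsSeparableState τ ∧ 1 = r • τ :=
  (eq_zero_or_eq_smul_of_mem_sepCone (one_mem_sepCone (d := d))).resolve_left one_ne_zero

theorem nonempty_idx {ψ : Hilb d} (hψ : ‖ψ‖ = 1) : Nonempty (Idx d) := by
  by_contra h
  rw [not_nonempty_iff] at h
  rw [Subsingleton.elim ψ 0, norm_zero] at hψ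
  exact zero_ne_one hψ

theorem posSemidef_one_sub_pureOp {ψ : Hilb d} (hψ : ‖ψ‖ = 1) : (1 - pureOp ψ).PosSemidef :=
  posSemidef_sub_pureOp Matrix.PosSemidef.one hψ (Matrix.one_mulVec _)

/-- A lower bound for all `r` such that `r • ω` dominates `|ψ⟩⟨ψ|` for some separable `ω` is a lower
bound for `1 + R(ψ)`. -/
theorem le_one_add_robustness {ψ : Hilb d} (hψ : ‖ψ‖ = 1) {a : ℝ}
    (h : ∀ (r : ℝ) (ω : Op d), 1 ≤ r → IsSeparableState ω → (r • ω - pureOp ψ).PosSemidef → a ≤ r) :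
    a ≤ 1 + robustness (pureOp ψ) := by
  have := nonempty_idx hψ
  obtain ⟨r, -, τ, hτ, hr⟩ := exists_smul_eq_one (d := d)
  have : a - 1 ≤ robustness (pureOp ψ) := by
    refine le_csInf ⟨r - 1, admissible_of_posSemidef (isDensity_pureOp hψ) hτ
      (hr ▸ posSemidef_one_sub_pureOp hψ)⟩ ?_
    rintro t ⟨ht, Δ, hΔ, hω⟩
    have h1 : 1 + t ≠ 0 := by linarith
    have := h (1 + t) _ (by linarith) hω (by
      rw [smul_smul, mul_inv_cancel₀ h1, one_smul, add_sub_cancel_left]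
      exact posSemidef_real_smul hΔ.1 ht)
    linarith
  linarith

/-- A separable operator `E` that fixes the unit vector `ψ` bounds its robustness, since
`E / tr E` is a mixture of `|ψ⟩⟨ψ|` with another state. -/
theorem one_add_robustness_le_trace {E : Op d} (hE : E ∈ sepCone d) {ψ : Hilb d} (hψ : ‖ψ‖ = 1)
    (hfix : E *ᵥ ψ.ofLp = ψ.ofLp) : 1 + robustness (pureOp ψ) ≤ E.trace.re := by
  have hsub := posSemidef_sub_pureOp (posSemidef_of_mem_sepCone hE) hψ hfix
  rcases eq_zero_or_eq_smul_of_mem_sepCone hE with rfl | ⟨r, -, ω, hω, rfl⟩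
  · rw [Matrix.zero_mulVec] at hfix
    have : ψ = 0 := WithLp.ofLp_injective 2 (by simpa using hfix.symm)
    rw [this, norm_zero] at hψ
    exact absurd hψ zero_ne_one
  · rw [Matrix.trace_smul, hω.isDensity.2]
    simpa using one_add_robustness_le (isDensity_pureOp hψ) hω hsub

/-- The robustness is Lipschitz continuous on the unit sphere: adding the multiple
`2 ‖ψ - φ‖` of the identity to a separable operator that dominates `|φ⟩⟨φ|` gives one that dominates
`|ψ⟩⟨ψ|`. -/
theorem robustness_le_add {φ ψ : Hilb d} (hφ : ‖φ‖ = 1) (hψ : ‖ψ‖ = 1) {s : ℝ} (hs : 0 < s)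
    {τ : Op d} (hτ : IsSeparableState τ) (hone : 1 = s • τ) :
    robustness (pureOp ψ) ≤ robustness (pureOp φ) + 2 * s * ‖ψ - φ‖ := by
  have : 1 + robustness (pureOp ψ) - 2 * s * ‖ψ - φ‖ ≤ 1 + robustness (pureOp φ) := by
    refine le_one_add_robustness hφ fun r ω hr hω h => ?_
    obtain ⟨ω', hω', hsum⟩ := hω.smul_add_smul hτ (r := r) (s := 2 * ‖ψ - φ‖ * s) (by linarith)
      (by positivity)
    have hps := h.add (posSemidef_add_pureOp_sub_pureOp hφ hψ)
    have := one_add_robustness_le (isDensity_pureOp hψ) hω' (r := r + 2 * ‖ψ - φ‖ * s) (by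
      rw [← hsum]
      convert hps using 1
      rw [hone, smul_smul]
      abel)
    linarith
  linarith

/-- A nonzero subspace contains a unit vector of maximal robustness. -/
theorem exists_isMaxRobust {s : Submodule ℂ (Hilb d)} (hs : s ≠ ⊥) : ∃ Ψ, IsMaxRobust s Ψ := by
  obtain ⟨v, hv, hv0⟩ := s.exists_mem_ne_zero_of_ne_bot hs
  have hu : ‖((‖v‖ : ℂ)⁻¹ • v)‖ = 1 := by
    rw [norm_smul, norm_inv, Complex.norm_real, norm_norm, inv_mul_cancel₀ (norm_ne_zero_iff.mpr hv0)]
  have := nonempty_idx hu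
  obtain ⟨c, hc, τ, hτ, hone⟩ := exists_smul_eq_one (d := d)
  have hcompact : IsCompact (Metric.sphere (0 : Hilb d) 1 ∩ s) :=
    (isCompact_sphere _ _).inter_right s.closed_of_finiteDimensional
  have hcont : ContinuousOn (fun ψ => robustness (pureOp ψ)) (Metric.sphere (0 : Hilb d) 1 ∩ s) := by
    refine LipschitzOnWith.continuousOn (K := ⟨2 * c, by positivity⟩)
      (LipschitzOnWith.of_le_add_mul _ fun ψ hψ φ hφ => ?_)
    rw [dist_eq_norm]
    exact robustness_le_add (by simpa using hφ.1) (by simpa using hψ.1) hc hτ hone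
  obtain ⟨Ψ, hΨ, hmax⟩ := hcompact.exists_isMaxOn
    ⟨(‖v‖ : ℂ)⁻¹ • v, by simpa using hu, s.smul_mem _ hv⟩ hcont
  exact ⟨Ψ, hΨ.2, by simpa using hΨ.1, fun ψ hψ hn => hmax ⟨by simpa using hn, hψ⟩⟩

end Robustness

/-! ### The measurement implemented by an LOCC protocol -/

section LOCC

variable {n : ℕ} {d : Fin n → ℕ} {N : ℕ}

/-- The effects of the measurement that a protocol implements, in the Heisenberg picture: the
operators `E i` with `P.prob ρ i = tr (E i * ρ)`. -/
noncomputable def LOCCProtocol.effect : LOCCProtocol d N → Fin N → Op d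
  | .announce i', i => if i' = i then 1 else 0
  | .measure k _ A _ next, i => ∑ j, (localOp k (A j))ᴴ * (next j).effect i * localOp k (A j)

theorem LOCCProtocol.prob_eq (P : LOCCProtocol d N) (ρ : Op d) (i : Fin N) :
    P.prob ρ i = (P.effect i * ρ).trace.re := by
  induction P generalizing ρ with
  | announce i' => by_cases h : i' = i <;> simp [prob, effect, h]
  | measure k m A hA next ih =>
    simp only [prob, effect, ih, Finset.sum_mul, Matrix.trace_sum, Complex.re_sum]
    refine Finset.sum_congr rfl fun j _ => ?_
    rw [← mul_assoc, ← mul_assoc, Matrix.trace_mul_comm, ← mul_assoc, ← mul_assoc]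

theorem LOCCProtocol.effect_mem_sepCone (P : LOCCProtocol d N) (i : Fin N) :
    P.effect i ∈ sepCone d := by
  induction P with
  | announce i' =>
    by_cases h : i' = i
    · simpa [effect, h] using one_mem_sepCone
    · simp [effect, h]
  | measure k m A hA next ih => exact sum_mem fun j _ => localOp_conj_mem_sepCone k _ (ih j)

theorem LOCCProtocol.sum_effect (P : LOCCProtocol d N) : ∑ i, P.effect i = 1 := by
  induction P with
  | announce i' => simp [effect]
  | measure k m A hA next ih =>
    simp only [effect]
    rw [Finset.sum_comm]
    simp only [← Finset.sum_mul, ← Finset.mul_sum, ih, mul_one, localOp_conjTranspose_mul_self]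
    rw [← localOp_sum, hA, localOp_one]

theorem LOCCProtocol.posSemidef_one_sub_effect (P : LOCCProtocol d N) (i : Fin N) :
    (1 - P.effect i).PosSemidef := by
  rw [← P.sum_effect, ← Finset.sum_erase_eq_sub (Finset.mem_univ i)]
  exact Matrix.posSemidef_sum _ fun j _ => posSemidef_of_mem_sepCone (P.effect_mem_sepCone j)

end LOCC

/-! ### Operators acting on the support of a state -/

section Support

variable {n : ℕ} {d : Fin n → ℕ}

theorem mul_eq_zero_of_trace_mul_eq_zero {ι : Type*} [Fintype ι] {A B : Matrix ι ι ℂ}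
    (hA : A.PosSemidef) (hB : B.PosSemidef) (h : (A * B).trace.re = 0) : A * B = 0 := by
  obtain ⟨C, rfl⟩ := exists_eq_conjTranspose_mul_self hA
  obtain ⟨E, rfl⟩ := exists_eq_conjTranspose_mul_self hB
  have h1 : (Cᴴ * C * (Eᴴ * E)).trace = ((C * Eᴴ)ᴴ * (C * Eᴴ)).trace := by
    rw [Matrix.conjTranspose_mul, Matrix.conjTranspose_conjTranspose, ← mul_assoc,
      Matrix.trace_mul_comm, ← mul_assoc, ← mul_assoc, ← mul_assoc]
  have h2 : ((C * Eᴴ)ᴴ * (C * Eᴴ)).trace = 0 := by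
    rw [trace_eq_re (Matrix.posSemidef_conjTranspose_mul_self _), ← h1, h, Complex.ofReal_zero]
  rw [Matrix.trace_conjTranspose_mul_self_eq_zero_iff] at h2
  rw [mul_assoc, ← mul_assoc C, h2, zero_mul, mul_zero]

theorem mulVec_eq_smul_of_mem_opSupport {A ρ : Op d} {c : ℂ} (h : A * ρ = c • ρ) {v : Hilb d}
    (hv : v ∈ opSupport ρ) : A *ᵥ v.ofLp = c • v.ofLp := by
  induction hv using Submodule.span_induction with
  | mem v hv =>
    obtain ⟨μ, hμ, hv⟩ := hv
    have hv' : ρ *ᵥ v.ofLp = μ • v.ofLp := congrArg WithLp.ofLp hv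
    have h1 : μ • (A *ᵥ v.ofLp) = μ • (c • v.ofLp) := by
      rw [← Matrix.mulVec_smul, ← hv', Matrix.mulVec_mulVec, h, Matrix.smul_mulVec, hv',
        smul_comm]
    exact smul_right_injective _ hμ h1
  | zero => simp
  | add v w _ _ hv hw => simp [Matrix.mulVec_add, hv, hw]
  | smul a v _ hv => simp [Matrix.mulVec_smul, hv, smul_comm a c]

theorem opSupport_ne_bot {ρ : Op d} (hρ : IsDensity ρ) : opSupport ρ ≠ ⊥ := by
  intro h
  have h0 : ρ ≠ 0 := by
    rintro rfl
    simpa using hρ.2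
  obtain ⟨v, μ, hμ, hv0, hv⟩ := hρ.1.1.exists_eigenvector_of_ne_zero h0
  have hmem : WithLp.toLp 2 v ∈ opSupport ρ := by
    refine Submodule.subset_span ⟨μ, by exact_mod_cast hμ, ?_⟩
    rw [Matrix.toLpLin_apply, hv, ← WithLp.toLp_smul]
    rfl
  rw [h, Submodule.mem_bot] at hmem
  exact hv0 (by simpa using hmem)

/-- The effects of a protocol that identifies the states `σ j` act as the identity on the support
of the state they announce, and as zero on the supports of the others. -/
theorem LOCCProtocol.effect_mulVec {N : ℕ} {σ : Fin N → Op d} (hσ : ∀ i, IsDensity (σ i))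
    {P : LOCCProtocol d N} (hP : ∀ i j, P.prob (σ j) i = if i = j then 1 else 0) (i j : Fin N)
    {v : Hilb d} (hv : v ∈ opSupport (σ j)) :
    P.effect i *ᵥ v.ofLp = if i = j then v.ofLp else 0 := by
  have h := hP i j
  rw [prob_eq] at h
  split_ifs at h ⊢ with hij
  · have h1 : (1 - P.effect i) * σ j = 0 := by
      refine mul_eq_zero_of_trace_mul_eq_zero (P.posSemidef_one_sub_effect i) (hσ j).1 ?_
      rw [sub_mul, one_mul, Matrix.trace_sub, Complex.sub_re, h, (hσ j).2, Complex.one_re, sub_self]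
    rw [sub_mul, one_mul, sub_eq_zero] at h1
    simpa using mulVec_eq_smul_of_mem_opSupport (c := 1) (by rw [one_smul]; exact h1.symm) hv
  · have h1 : P.effect i * σ j = 0 := mul_eq_zero_of_trace_mul_eq_zero
      (posSemidef_of_mem_sepCone (P.effect_mem_sepCone i)) (hσ j).1 h
    simpa using mulVec_eq_smul_of_mem_opSupport (c := 0) (by rw [zero_smul]; exact h1) hv

/-- Vectors in the supports of different perfectly distinguishable states are orthogonal. -/
theorem LOCCProtocol.inner_eq_zero {N : ℕ} {σ : Fin N → Op d} (hσ : ∀ i, IsDensity (σ i))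
    {P : LOCCProtocol d N} (hP : ∀ i j, P.prob (σ j) i = if i = j then 1 else 0) {i j : Fin N}
    (hij : i ≠ j) {v w : Hilb d} (hv : v ∈ opSupport (σ i)) (hw : w ∈ opSupport (σ j)) :
    inner ℂ v w = 0 := by
  have hH : (P.effect i)ᴴ = P.effect i := (posSemidef_of_mem_sepCone (P.effect_mem_sepCone i)).1
  have h1 := P.effect_mulVec hσ hP i i hv
  have h2 := P.effect_mulVec hσ hP i j hw
  rw [if_pos rfl] at h1
  rw [if_neg hij] at h2
  rw [EuclideanSpace.inner_eq_star_dotProduct, dotProduct_comm, ← h1, Matrix.star_mulVec, hH,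
    ← Matrix.dotProduct_mulVec, h2, dotProduct_zero]

end Support

/-! ### Spectral weights of a vector -/

section Spectral

variable {n : ℕ} {d : Fin n → ℕ}

/-- The coordinates of `ψ` in an orthonormal eigenbasis of the Hermitian operator `ω`. -/
noncomputable def eigenCoord {ω : Op d} (hω : ω.IsHermitian) (ψ : Hilb d) : Idx d → ℂ :=
  (hω.eigenvectorUnitary : Op d)ᴴ *ᵥ ψ.ofLp

/-- The probability of each eigenvector of `ω` in a measurement of the state `ψ`. -/
noncomputable def eigenWeight {ω : Op d} (hω : ω.IsHermitian) (ψ : Hilb d) (x : Idx d) : ℝ :=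
  ‖eigenCoord hω ψ x‖ ^ 2

theorem eigenWeight_nonneg {ω : Op d} (hω : ω.IsHermitian) (ψ : Hilb d) (x : Idx d) :
    0 ≤ eigenWeight hω ψ x := sq_nonneg _

theorem star_dotProduct_diagonal {ι : Type*} [Fintype ι] [DecidableEq ι] (f : ι → ℝ) (w : ι → ℂ) :
    star w ⬝ᵥ Matrix.diagonal (fun x => (f x : ℂ)) *ᵥ w = ((∑ x, ‖w x‖ ^ 2 * f x : ℝ) : ℂ) := by
  rw [dotProduct, Complex.ofReal_sum]
  refine Finset.sum_congr rfl fun x _ => ?_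
  rw [Matrix.mulVec_diagonal, Pi.star_apply, Complex.ofReal_mul, Complex.ofReal_pow,
    ← Complex.conj_mul', Complex.star_def]
  ring

theorem star_dotProduct_conj_mulVec {ι κ : Type*} [Fintype ι] [Fintype κ] (U : Matrix ι κ ℂ)
    (D : Matrix κ κ ℂ) (v : ι → ℂ) :
    star v ⬝ᵥ (U * D * Uᴴ) *ᵥ v = star (Uᴴ *ᵥ v) ⬝ᵥ D *ᵥ (Uᴴ *ᵥ v) := by
  rw [Matrix.star_mulVec, Matrix.conjTranspose_conjTranspose, ← Matrix.mulVec_mulVec,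
    ← Matrix.mulVec_mulVec, Matrix.dotProduct_mulVec]

theorem trace_pureOp_mul_cfc {ω : Op d} (hω : ω.IsHermitian) (ψ : Hilb d) (f : ℝ → ℝ) :
    (pureOp ψ * cfc f ω).trace = ((∑ x, eigenWeight hω ψ x * f (hω.eigenvalues x) : ℝ) : ℂ) := by
  rw [trace_pureOp_mul, hω.cfc_eq, Matrix.IsHermitian.cfc, Unitary.conjStarAlgAut_apply,
    Matrix.star_eq_conjTranspose, star_dotProduct_conj_mulVec]
  exact star_dotProduct_diagonal _ _

theorem trace_pureOp_mul_self {ω : Op d} (hω : ω.IsHermitian) (ψ : Hilb d) :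
    (pureOp ψ * ω).trace = ((∑ x, eigenWeight hω ψ x * hω.eigenvalues x : ℝ) : ℂ) := by
  have h := trace_pureOp_mul_cfc hω ψ id
  rwa [hω.cfc_eq, Matrix.IsHermitian.cfc, Function.id_comp, ← hω.spectral_theorem] at h

theorem eigenvectorUnitary_mulVec_eigenCoord {ω : Op d} (hω : ω.IsHermitian) (ψ : Hilb d) :
    (hω.eigenvectorUnitary : Op d) *ᵥ eigenCoord hω ψ = ψ.ofLp := by
  rw [eigenCoord, Matrix.mulVec_mulVec, ← Matrix.star_eq_conjTranspose,
    Unitary.mul_star_self_of_mem (SetLike.coe_mem _), Matrix.one_mulVec]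

theorem sum_eigenWeight {ω : Op d} (hω : ω.IsHermitian) {ψ : Hilb d} (hψ : ‖ψ‖ = 1) :
    ∑ x, eigenWeight hω ψ x = 1 := by
  have h := star_dotProduct_conj_mulVec (hω.eigenvectorUnitary : Op d)
    (Matrix.diagonal fun _ => ((1 : ℝ) : ℂ)) ψ.ofLp
  rw [star_dotProduct_diagonal, Complex.ofReal_one, Matrix.diagonal_one, mul_one,
    ← Matrix.star_eq_conjTranspose, Unitary.mul_star_self_of_mem (SetLike.coe_mem _), Matrix.one_mulVec,
    star_dotProduct_self_eq_one hψ] at h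
  simpa [eigenWeight, eigenCoord, Matrix.star_eq_conjTranspose] using (Complex.ofReal_eq_one.mp h.symm)

theorem conjTranspose_mulVec_mulVec {ω : Op d} (hω : ω.IsHermitian) (v : Idx d → ℂ) :
    (hω.eigenvectorUnitary : Op d)ᴴ *ᵥ (ω *ᵥ v) =
      fun x => (hω.eigenvalues x : ℂ) * ((hω.eigenvectorUnitary : Op d)ᴴ *ᵥ v) x := by
  have h := hω.spectral_theorem
  rw [Unitary.conjStarAlgAut_apply] at h
  nth_rewrite 2 [h]
  rw [← Matrix.mulVec_mulVec, ← Matrix.mulVec_mulVec, Matrix.mulVec_mulVec,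
    ← Matrix.star_eq_conjTranspose, Unitary.star_mul_self_of_mem (SetLike.coe_mem _), Matrix.one_mulVec]
  funext x
  rw [Matrix.mulVec_diagonal]
  rfl

/-- A pure state lies in the support of `ω` iff it has no weight in the kernel of `ω`. -/
theorem opSupport_pureOp_le_iff {ω : Op d} (hω : ω.IsHermitian) {ψ : Hilb d} (hψ : ‖ψ‖ = 1) :
    opSupport (pureOp ψ) ≤ opSupport ω ↔
      ∀ x, hω.eigenvalues x = 0 → eigenWeight hω ψ x = 0 := by
  constructor
  · intro h x hx
    have hmem : ∀ v ∈ opSupport ω, eigenCoord hω v x = 0 := by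
      intro v hv
      induction hv using Submodule.span_induction with
      | mem v hv =>
        obtain ⟨μ, hμ, hv⟩ := hv
        have hv' : ω *ᵥ v.ofLp = μ • v.ofLp := congrArg WithLp.ofLp hv
        have h1 := congrFun (conjTranspose_mulVec_mulVec hω v.ofLp) x
        rw [hv', Matrix.mulVec_smul, hx, Complex.ofReal_zero, zero_mul, Pi.smul_apply,
          smul_eq_mul] at h1
        exact (mul_eq_zero.mp h1).resolve_left hμ
      | zero => simp [eigenCoord]
      | add v w _ _ hv hw =>
        simp only [eigenCoord] at hv hw
        simp [eigenCoord, Matrix.mulVec_add, hv, hw]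
      | smul a v _ hv =>
        simp only [eigenCoord] at hv
        simp [eigenCoord, Matrix.mulVec_smul, hv]
    simp [eigenWeight, hmem ψ (h (mem_opSupport_pureOp hψ))]
  · intro h
    have hψmem : ψ ∈ opSupport ω := by
      have h1 : ψ = ∑ x, eigenCoord hω ψ x • hω.eigenvectorBasis x := by
        apply WithLp.ofLp_injective 2
        rw [← eigenvectorUnitary_mulVec_eigenCoord hω ψ]
        funext y
        simp [Matrix.mulVec, dotProduct, mul_comm]
      rw [h1]
      refine Submodule.sum_mem _ fun x _ => ?_
      by_cases hx : hω.eigenvalues x = 0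
      · have : eigenCoord hω ψ x = 0 := by simpa [eigenWeight] using h x hx
        rw [this, zero_smul]
        exact zero_mem _
      · refine Submodule.smul_mem _ _ (Submodule.subset_span
          ⟨hω.eigenvalues x, by exact_mod_cast hx, ?_⟩)
        rw [Matrix.toLpLin_apply, hω.mulVec_eigenvectorBasis, ← Complex.coe_smul]
        rfl
    refine Submodule.span_le.mpr ?_
    rintro v ⟨μ, hμ, hv⟩
    rw [Matrix.toLpLin_apply, pureOp_mulVec, WithLp.toLp_smul, WithLp.toLp_ofLp] at hv
    have : v = μ⁻¹ • (star ψ.ofLp ⬝ᵥ v.ofLp) • ψ := by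
      rw [hv, smul_smul, inv_mul_cancel₀ hμ, one_smul]
    rw [this]
    exact Submodule.smul_mem _ _ (Submodule.smul_mem _ _ hψmem)

theorem opLog_pureOp {ψ : Hilb d} (hψ : ‖ψ‖ = 1) : opLog (pureOp ψ) = 0 := by
  have hidem : IsIdempotentElem (pureOp ψ) := pureOp_mul_self hψ
  have h : (spectrum ℝ (pureOp ψ)).EqOn (Real.logb 2) 0 := by
    intro x hx
    rcases hidem.spectrum_subset ℝ hx with rfl | rfl <;> simp
  rw [opLog, cfc_congr h]
  exact cfc_zero ℝ _

/-- For pure `ψ`, the relative entropy to `ω` is `-⟨ψ| log₂ ω |ψ⟩`. -/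
theorem relEntropy_pureOp {ω : Op d} (hω : ω.IsHermitian) {ψ : Hilb d} (hψ : ‖ψ‖ = 1)
    (h : ∀ x, hω.eigenvalues x = 0 → eigenWeight hω ψ x = 0) :
    relEntropy (pureOp ψ) ω =
      ((-∑ x, eigenWeight hω ψ x * Real.logb 2 (hω.eigenvalues x) : ℝ) : EReal) := by
  rw [relEntropy, if_pos ((opSupport_pureOp_le_iff hω hψ).mpr h), opLog_pureOp hψ, zero_sub,
    mul_neg, Matrix.trace_neg, opLog, trace_pureOp_mul_cfc hω, ← Complex.ofReal_neg,
    Complex.ofReal_re]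

end Spectral

/-! ### Two logarithmic inequalities -/

section Log

variable {ι : Type*} [Fintype ι] {p l : ι → ℝ}

/-- Jensen's inequality for the logarithm, with weights that vanish where its argument does. -/
theorem sum_mul_logb_le_logb_sum (hp : ∀ x, 0 ≤ p x) (hsum : ∑ x, p x = 1) (hl : ∀ x, 0 ≤ l x)
    (hzero : ∀ x, l x = 0 → p x = 0) {m : ℝ} (hm : ∑ x, p x * l x ≤ m) (hm0 : 0 < m) :
    ∑ x, p x * Real.logb 2 (l x) ≤ Real.logb 2 m := by
  have h2 : 0 < Real.log 2 := Real.log_pos one_lt_two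
  have h : ∑ x, p x * Real.log (l x) - Real.log m ≤ 0 := by
    calc ∑ x, p x * Real.log (l x) - Real.log m
        = ∑ x, (p x * Real.log (l x) - p x * Real.log m) := by
          rw [Finset.sum_sub_distrib, ← Finset.sum_mul, hsum, one_mul]
      _ ≤ ∑ x, (p x * l x / m - p x) := by
          refine Finset.sum_le_sum fun x _ => ?_
          by_cases hx : l x = 0
          · simp [hzero x hx]
          · have hlx : 0 < l x := lt_of_le_of_ne (hl x) (Ne.symm hx)
            have h1 := Real.log_le_sub_one_of_pos (div_pos hlx hm0)
            rw [Real.log_div hx hm0.ne'] at h1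
            calc _ = p x * (Real.log (l x) - Real.log m) := by ring
              _ ≤ p x * (l x / m - 1) := mul_le_mul_of_nonneg_left h1 (hp x)
              _ = _ := by ring
      _ = (∑ x, p x * l x) / m - 1 := by
          rw [Finset.sum_sub_distrib, hsum, Finset.sum_div]
      _ ≤ 0 := by
          rw [sub_nonpos, div_le_one hm0]
          exact hm
  simp only [Real.logb, ← mul_div_assoc, ← Finset.sum_div]
  exact div_le_div_of_nonneg_right (by linarith) h2.le

theorem neg_logb_le_sum_mul_logb (hp : ∀ x, 0 ≤ p x) (hsum : ∑ x, p x = 1) (hl : ∀ x, 0 ≤ l x)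
    (hzero : ∀ x, l x = 0 → p x = 0) {r : ℝ} (hr : ∑ x, p x / l x ≤ r) (hr0 : 0 < r) :
    -Real.logb 2 r ≤ ∑ x, p x * Real.logb 2 (l x) := by
  have h := sum_mul_logb_le_logb_sum (l := fun x => (l x)⁻¹) hp hsum
    (fun x => inv_nonneg.mpr (hl x)) (fun x hx => hzero x (inv_eq_zero.mp hx)) (m := r)
    (by simpa [div_eq_mul_inv] using hr) hr0
  simp only [Real.logb_inv, mul_neg, Finset.sum_neg_distrib] at h
  linarith

/-- If the diagonal matrix with entries `r * l x` dominates `|w⟩⟨w|` then `w` vanishes where `l`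
does, and `⟨w| diag(l)⁻¹ |w⟩ ≤ r`. The test vector is `diag(l)⁻¹ w`. -/
theorem sum_div_le_of_posSemidef [DecidableEq ι] {r : ℝ} {w : ι → ℂ} (hl : ∀ x, 0 ≤ l x)
    (h : (Matrix.diagonal (fun x => ((r * l x : ℝ) : ℂ)) -
      Matrix.vecMulVec w (star w)).PosSemidef) (hr : 0 ≤ r) :
    (∀ x, l x = 0 → ‖w x‖ ^ 2 = 0) ∧ ∑ x, ‖w x‖ ^ 2 / l x ≤ r := by
  constructor
  · intro x hx
    have h1 := h.diag_nonneg (i := x)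
    simp only [Matrix.sub_apply, Matrix.diagonal_apply_eq, hx, Matrix.vecMulVec_apply,
      Pi.star_apply, Complex.star_def, Complex.mul_conj, Complex.normSq_eq_norm_sq, mul_zero,
      ← Complex.ofReal_sub, Complex.zero_le_real] at h1
    exact le_antisymm (by linarith) (sq_nonneg _)
  · set S : ℝ := ∑ x, ‖w x‖ ^ 2 / l x with hS
    have hS0 : 0 ≤ S := Finset.sum_nonneg fun x _ => div_nonneg (sq_nonneg _) (hl x)
    set v : ι → ℂ := fun x => w x / l x with hv
    have h1 := h.dotProduct_mulVec_nonneg v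
    have hw : star w ⬝ᵥ v = (S : ℂ) := by
      rw [dotProduct, hS, Complex.ofReal_sum]
      refine Finset.sum_congr rfl fun x _ => ?_
      rw [Pi.star_apply, hv, Complex.star_def, ← mul_div_assoc, Complex.conj_mul']
      push_cast
      rfl
    have hw' : star v ⬝ᵥ w = (S : ℂ) := by
      have : star v ⬝ᵥ w = star (star w ⬝ᵥ v) := Matrix.star_dotProduct _ _
      rw [this, hw, Complex.star_def, Complex.conj_ofReal]
    have hd : ∑ x, ‖v x‖ ^ 2 * (r * l x) = r * S := by
      rw [hS, Finset.mul_sum]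
      refine Finset.sum_congr rfl fun x _ => ?_
      rw [hv, norm_div, Complex.norm_real, Real.norm_of_nonneg (hl x)]
      by_cases hx : l x = 0
      · simp [hx]
      · field_simp
    rw [Matrix.sub_mulVec, dotProduct_sub, star_dotProduct_diagonal, hd, Matrix.vecMulVec_mulVec,
      op_smul_eq_smul, dotProduct_smul, hw, hw', smul_eq_mul, ← Complex.ofReal_mul,
      ← Complex.ofReal_sub, Complex.zero_le_real] at h1
    by_contra! hlt
    nlinarith

end Log

/-! ### Overlap with product vectors -/

section Overlap

variable {n : ℕ} {d : Fin n → ℕ}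

theorem norm_tensorVec (v : (k : Fin n) → EuclideanSpace ℂ (Fin (d k))) :
    ‖tensorVec v‖ ^ 2 = ∏ k, ‖v k‖ ^ 2 := by
  simp only [EuclideanSpace.norm_sq_eq]
  rw [Finset.prod_univ_sum, Fintype.piFinset_univ]
  simp [tensorVec, Finset.prod_pow]

/-- The maximal squared overlap of `ψ` with a product unit vector, so that
`geometricMeasure ψ = -log₂ (maxOverlap ψ)`. -/
noncomputable def maxOverlap (ψ : Hilb d) : ℝ :=
  sSup {x : ℝ | ∃ v : (k : Fin n) → EuclideanSpace ℂ (Fin (d k)),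
    (∀ k, ‖v k‖ = 1) ∧ x = ‖inner ℂ (tensorVec v) ψ‖ ^ 2}

theorem overlap_le_maxOverlap (ψ : Hilb d) {v : (k : Fin n) → EuclideanSpace ℂ (Fin (d k))}
    (hv : ∀ k, ‖v k‖ = 1) : ‖inner ℂ (tensorVec v) ψ‖ ^ 2 ≤ maxOverlap ψ := by
  refine le_csSup ⟨‖ψ‖ ^ 2, ?_⟩ ⟨v, hv, rfl⟩
  rintro _ ⟨u, hu, rfl⟩
  have h1 : ‖tensorVec u‖ ^ 2 = 1 := by simp [norm_tensorVec, hu]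
  calc ‖inner ℂ (tensorVec u) ψ‖ ^ 2 ≤ (‖tensorVec u‖ * ‖ψ‖) ^ 2 :=
        pow_le_pow_left₀ (norm_nonneg _) (norm_inner_le_norm _ _) 2
    _ = ‖ψ‖ ^ 2 := by rw [mul_pow, h1, one_mul]

theorem IsDensity.sum_eigenvalues {ι : Type} [Fintype ι] [DecidableEq ι] {A : Matrix ι ι ℂ}
    (hA : IsDensity A) : ∑ x, hA.1.1.eigenvalues x = 1 := by
  have h := hA.1.1.trace_eq_sum_eigenvalues
  rw [hA.2] at h
  apply Complex.ofReal_injective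
  rw [Complex.ofReal_sum, Complex.ofReal_one]
  exact h.symm

/-- Diagonalizing every factor exhibits a product state as a mixture of pure product states. -/
theorem overlap_tensorOp_le (ψ : Hilb d) {M : (k : Fin n) → Matrix (Fin (d k)) (Fin (d k)) ℂ}
    (hM : ∀ k, IsDensity (M k)) : (pureOp ψ * tensorOp M).trace.re ≤ maxOverlap ψ := by
  set U : (k : Fin n) → Matrix (Fin (d k)) (Fin (d k)) ℂ :=
    fun k => (hM k).1.1.eigenvectorUnitary with hU
  set l : (k : Fin n) → Fin (d k) → ℝ := fun k => (hM k).1.1.eigenvalues with hl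
  have hdec : tensorOp M = tensorOp U *
      Matrix.diagonal (fun x => ((∏ k, l k (x k) : ℝ) : ℂ)) * (tensorOp U)ᴴ := by
    have h1 : Matrix.diagonal (fun x : Idx d => ((∏ k, l k (x k) : ℝ) : ℂ)) =
        tensorOp fun k => Matrix.diagonal fun i => (l k i : ℂ) := by
      rw [tensorOp_diagonal]
      simp
    rw [h1, tensorOp_conjTranspose, tensorOp_mul, tensorOp_mul]
    congr 1
    funext k
    have h2 := (hM k).1.1.spectral_theorem
    rw [Unitary.conjStarAlgAut_apply] at h2
    exact h2
  have hcoord : ∀ x, ((tensorOp U)ᴴ *ᵥ ψ.ofLp) x =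
      inner ℂ (tensorVec fun k => (hM k).1.1.eigenvectorBasis (x k)) ψ := by
    intro x
    rw [EuclideanSpace.inner_eq_star_dotProduct, dotProduct_comm]
    simp [Matrix.mulVec, dotProduct, tensorOp, tensorVec, hU]
  have hl0 : ∀ x : Idx d, 0 ≤ ∏ k, l k (x k) :=
    fun x => Finset.prod_nonneg fun k _ => (hM k).1.eigenvalues_nonneg _
  have hl1 : ∑ x : Idx d, ∏ k, l k (x k) = 1 := by
    rw [← Fintype.piFinset_univ, ← Finset.prod_univ_sum]
    exact Finset.prod_eq_one fun k _ => (hM k).sum_eigenvalues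
  rw [trace_pureOp_mul, hdec, star_dotProduct_conj_mulVec, star_dotProduct_diagonal,
    Complex.ofReal_re]
  calc _ ≤ ∑ x : Idx d, maxOverlap ψ * ∏ k, l k (x k) := by
        refine Finset.sum_le_sum fun x _ => mul_le_mul_of_nonneg_right ?_ (hl0 x)
        rw [hcoord]
        exact overlap_le_maxOverlap ψ fun k => (hM k).1.1.eigenvectorBasis.norm_eq_one _
    _ = maxOverlap ψ := by rw [← Finset.mul_sum, hl1, mul_one]

theorem IsSeparableState.overlap_le (ψ : Hilb d) {ω : Op d} (hω : IsSeparableState ω) :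
    (pureOp ψ * ω).trace.re ≤ maxOverlap ψ := by
  have hconv : Convex ℝ {X : Op d | (pureOp ψ * X).trace.re ≤ maxOverlap ψ} := by
    intro A hA B hB a b ha hb hab
    simp only [Set.mem_ofPred_eq] at hA hB ⊢
    rw [mul_add, Matrix.mul_smul, Matrix.mul_smul, Matrix.trace_add, Matrix.trace_smul,
      Matrix.trace_smul, Complex.add_re, Complex.smul_re, Complex.smul_re, smul_eq_mul, smul_eq_mul]
    calc _ ≤ a * maxOverlap ψ + b * maxOverlap ψ :=
          add_le_add (mul_le_mul_of_nonneg_left hA ha) (mul_le_mul_of_nonneg_left hB hb)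
      _ = maxOverlap ψ := by rw [← add_mul, hab, one_mul]
  refine convexHull_min ?_ hconv hω
  rintro _ ⟨M, hM, rfl⟩
  exact overlap_tensorOp_le ψ hM

end Overlap

/-! ### Comparison of the entanglement measures of a pure state -/

section Comparison

variable {n : ℕ} {d : Fin n → ℕ}

theorem geometricMeasure_le_of_relEntropy_eq {ψ : Hilb d} (hψ : ‖ψ‖ = 1) {ω : Op d}
    (hω : IsSeparableState ω) {x : ℝ} (hx : relEntropy (pureOp ψ) ω = x) :
    geometricMeasure ψ ≤ x := by
  have hH := hω.isDensity.1.1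
  have hl := hω.isDensity.1.eigenvalues_nonneg
  have hsupp : opSupport (pureOp ψ) ≤ opSupport ω := by
    by_contra h
    rw [relEntropy, if_neg h] at hx
    exact EReal.coe_ne_top x hx.symm
  have hzero := (opSupport_pureOp_le_iff hH hψ).mp hsupp
  have hov : ∑ y, eigenWeight hH ψ y * hH.eigenvalues y ≤ maxOverlap ψ := by
    have h := hω.overlap_le ψ
    rwa [trace_pureOp_mul_self hH, Complex.ofReal_re] at h
  have hnn : ∀ y, 0 ≤ eigenWeight hH ψ y * hH.eigenvalues y :=
    fun y => mul_nonneg (eigenWeight_nonneg hH ψ y) (hl y)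
  have hpos : 0 < maxOverlap ψ := by
    refine lt_of_lt_of_le (lt_of_le_of_ne (Finset.sum_nonneg fun y _ => hnn y) fun h0 => ?_) hov
    have hall := (Finset.sum_eq_zero_iff_of_nonneg fun y _ => hnn y).mp h0.symm
    have hsum := sum_eigenWeight hH hψ
    rw [Finset.sum_eq_zero fun y hy => ?_] at hsum
    · exact zero_ne_one hsum
    · exact (mul_eq_zero.mp (hall y hy)).elim id (hzero y)
  rw [relEntropy_pureOp hH hψ hzero, EReal.coe_eq_coe_iff] at hx
  rw [← hx]
  exact neg_le_neg (sum_mul_logb_le_logb_sum (eigenWeight_nonneg hH ψ) (sum_eigenWeight hH hψ)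
    hl hzero hov hpos)

/-- If `r • ω` dominates `|ψ⟩⟨ψ|` then the relative entropy of `ψ` to `ω` is at most `log₂ r`. -/
theorem exists_relEntropy_eq {ψ : Hilb d} (hψ : ‖ψ‖ = 1) {ω : Op d} (hω : IsDensity ω) {r : ℝ}
    (hr : 0 < r) (h : (r • ω - pureOp ψ).PosSemidef) :
    ∃ x ≤ Real.logb 2 r, relEntropy (pureOp ψ) ω = (x : EReal) := by
  have hH := hω.1.1
  have hl := hω.1.eigenvalues_nonneg
  have hconj : (Matrix.diagonal (fun x => ((r * hH.eigenvalues x : ℝ) : ℂ)) -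
      Matrix.vecMulVec (eigenCoord hH ψ) (star (eigenCoord hH ψ))).PosSemidef := by
    have h1 := h.conjTranspose_mul_mul_same (hH.eigenvectorUnitary : Op d)
    have h2 := hH.conjStarAlgAut_star_eigenvectorUnitary
    rw [Unitary.conjStarAlgAut_star_apply, Matrix.star_eq_conjTranspose] at h2
    convert h1 using 1
    rw [mul_sub, sub_mul, Matrix.mul_smul, Matrix.smul_mul, h2]
    congr 1
    · ext x y
      by_cases hxy : x = y
      · subst hxy; simp
      · simp [hxy]
    · rw [pureOp, Matrix.mul_vecMulVec, Matrix.vecMulVec_mul, eigenCoord, Matrix.star_mulVec,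
        Matrix.conjTranspose_conjTranspose]
  obtain ⟨hzero, hsum⟩ := sum_div_le_of_posSemidef hl hconj hr.le
  refine ⟨_, ?_, relEntropy_pureOp hH hψ hzero⟩
  rw [neg_le]
  exact neg_logb_le_sum_mul_logb (eigenWeight_nonneg hH ψ) (sum_eigenWeight hH hψ) hl hzero hsum hr

theorem geometricMeasure_le_relEntropyEnt {ψ : Hilb d} (hψ : ‖ψ‖ = 1) :
    geometricMeasure ψ ≤ relEntropyEnt (pureOp ψ) := by
  have := nonempty_idx hψ
  obtain ⟨r, hr, τ, hτ, hone⟩ := exists_smul_eq_one (d := d)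
  obtain ⟨x, -, hx⟩ := exists_relEntropy_eq hψ hτ.isDensity hr
    (hone ▸ posSemidef_one_sub_pureOp hψ)
  refine le_csInf ⟨x, τ, hτ, hx⟩ ?_
  rintro y ⟨ω, hω, hy⟩
  exact geometricMeasure_le_of_relEntropy_eq hψ hω hy

theorem two_rpow_relEntropyEnt_le {ψ : Hilb d} (hψ : ‖ψ‖ = 1) :
    (2 : ℝ) ^ relEntropyEnt (pureOp ψ) ≤ 1 + robustness (pureOp ψ) := by
  refine le_one_add_robustness hψ fun r ω hr hω h => ?_
  have hr0 : 0 < r := by linarith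
  obtain ⟨x, hxr, hx⟩ := exists_relEntropy_eq hψ hω.isDensity hr0 h
  have hle : relEntropyEnt (pureOp ψ) ≤ x := by
    refine csInf_le ⟨geometricMeasure ψ, ?_⟩ ⟨ω, hω, hx⟩
    rintro y ⟨τ, hτ, hy⟩
    exact geometricMeasure_le_of_relEntropy_eq hψ hτ hy
  calc (2 : ℝ) ^ relEntropyEnt (pureOp ψ) ≤ 2 ^ Real.logb 2 r :=
        Real.rpow_le_rpow_of_exponent_le one_le_two (hle.trans hxr)
    _ = r := Real.rpow_logb two_pos (by norm_num) hr0

end Comparison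

/-! ### The bound on the number of distinguishable states -/

theorem avg_pos {N : ℕ} (hN : 0 < N) {x : Fin N → ℝ} (hx : ∀ i, 0 < x i) : 0 < avg x :=
  div_pos (Finset.sum_pos (fun i _ => hx i) ⟨⟨0, hN⟩, Finset.mem_univ _⟩) (by exact_mod_cast hN)

theorem avg_le_avg {N : ℕ} {x y : Fin N → ℝ} (h : ∀ i, x i ≤ y i) : avg x ≤ avg y :=
  div_le_div_of_nonneg_right (Finset.sum_le_sum fun i _ => h i) (Nat.cast_nonneg N)

theorem theorem2 {n : ℕ} (d : Fin n → ℕ) {N : ℕ} (hN : 0 < N) (σ : Fin N → Op d)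
    (hσ : ∀ i, IsDensity (σ i)) (hdist : PerfectlyLOCCDistinguishable σ) :
    (∃ Ψ : Fin N → Hilb d, Orthonormal ℂ Ψ ∧ ∀ i, IsMaxRobust (opSupport (σ i)) (Ψ i)) ∧
    ∀ Ψ : Fin N → Hilb d, (∀ i, IsMaxRobust (opSupport (σ i)) (Ψ i)) →
      (N : ℝ) ≤ (Module.finrank ℂ (Hilb d) : ℝ) / avg (fun i => 1 + robustness (pureOp (Ψ i))) ∧
      (Module.finrank ℂ (Hilb d) : ℝ) / avg (fun i => 1 + robustness (pureOp (Ψ i))) ≤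
        (Module.finrank ℂ (Hilb d) : ℝ) /
          avg (fun i => (2 : ℝ) ^ relEntropyEnt (pureOp (Ψ i))) ∧
      (Module.finrank ℂ (Hilb d) : ℝ) / avg (fun i => (2 : ℝ) ^ relEntropyEnt (pureOp (Ψ i))) ≤
        (Module.finrank ℂ (Hilb d) : ℝ) /
          avg (fun i => (2 : ℝ) ^ geometricMeasure (Ψ i)) := by
  obtain ⟨P, hP⟩ := hdist
  refine ⟨?_, fun Ψ hΨ => ⟨?_, ?_, ?_⟩⟩
  · choose Ψ hΨ using fun i => exists_isMaxRobust (opSupport_ne_bot (hσ i))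
    exact ⟨Ψ, ⟨fun i => (hΨ i).2.1, fun i j hij => P.inner_eq_zero hσ hP hij (hΨ i).1 (hΨ j).1⟩, hΨ⟩
  · have hle : ∑ i, (1 + robustness (pureOp (Ψ i))) ≤ (Module.finrank ℂ (Hilb d) : ℝ) := by
      calc ∑ i, (1 + robustness (pureOp (Ψ i))) ≤ ∑ i, (P.effect i).trace.re :=
            Finset.sum_le_sum fun i _ => one_add_robustness_le_trace (P.effect_mem_sepCone i)
              (hΨ i).2.1 (by simpa using P.effect_mulVec hσ hP i i (hΨ i).1)
        _ = Module.finrank ℂ (Hilb d) := by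
            rw [← Complex.re_sum, ← Matrix.trace_sum, P.sum_effect, Matrix.trace_one,
              finrank_euclideanSpace, Complex.natCast_re]
    have hN' : (0 : ℝ) < N := by exact_mod_cast hN
    rw [le_div_iff₀ (avg_pos hN fun i => by linarith [zero_le_robustness (pureOp (Ψ i))]), avg,
      mul_div_cancel₀ _ hN'.ne']
    exact hle
  · exact div_le_div_of_nonneg_left (Nat.cast_nonneg _)
      (avg_pos hN fun i => Real.rpow_pos_of_pos two_pos _)
      (avg_le_avg fun i => two_rpow_relEntropyEnt_le (hΨ i).2.1)
  · exact div_le_div_of_nonneg_left (Nat.cast_nonneg _)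
      (avg_pos hN fun i => Real.rpow_pos_of_pos two_pos _)
      (avg_le_avg fun i => Real.rpow_le_rpow_of_exponent_le one_le_two
        (geometricMeasure_le_relEntropyEnt (hΨ i).2.1))
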